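/- **Theorem 3.3.** Let $\mathbb F$ be a finite field, let $n\ge 1$ be not divisible by $\operatorname{char}\mathbb F$, and let $A=\mathbb F[x]/\langle x^n-1\rangle$. Let $E\subseteq A$ be the set of primitive idempotents of $A$: for each monic prime factor $\pi$ of $x^n-1$ it contains the unique $\varepsilon\in A$ with $\varepsilon\equiv 1 \bmod \pi$ and $\varepsilon\equiv 0\bmod\pi'$ for every other monic prime factor $\pi'$ of $x^n-1$. Let $\sigma$ be an $\mathbb F$-algebra automorphism of $A$, let $\emptyset\neq S\subseteq E$, and let $m,b\in\mathbb N$ be such that $S\cap\sigma^j(S)=\emptyset$ for all $1\le j\le b$ and $1\le m\le b$. Put $c=\sum_{\varepsilon\in S}\varepsilon$ and $k=\dim_{\mathbb F}\langle c\rangle$, where $\langle c\rangle\subseteq A$ is the ideal generated by $c$. Let $A[z;\sigma]$ be the skew polynomial ring with elements $\sum_\nu z^\nu a_\nu$ ($a_\nu\in A$) and multiplication determined by $az=z\sigma(a)$ for $a\in A$; it is a left $\mathbb F[z]$-module. Let $\mathfrak v:A\to\mathbb F^n$ be the inverse of $(v_0,\dots,v_{n-1})\mapsto\sum_i v_ix^i$,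 extended to the isomorphism of left $\mathbb F[z]$-modules $\mathfrak v:A[z;\sigma]\to\mathbb F[z]^n$, $\sum_\nu z^\nu a_\nu\mapsto\sum_\nu z^\nu\mathfrak v(a_\nu)$. Define $$g=c\sum_{\nu=0}^m z^\nu=\sum_{\nu=0}^m z^\nu\sigma^\nu(c)\in A[z;\sigma],\qquad G=\sum_{\nu=0}^m z^\nu G_\nu\in\mathbb F[z]^{k\times n},$$ where $G_\nu\in\mathbb F^{k\times n}$ has the rows $\mathfrak v(\sigma^\nu(c)),\mathfrak v(\sigma^\nu(xc)),\dots,\mathfrak v(\sigma^\nu(x^{k-1}c))$, and let $\mathcal C=\operatorname{im}G=\{wG\mid w\in\mathbb F[z]^k\}$. Then: (a) $g=c\,(1+z\sigma(c))(1+z\sigma^2(c))\cdots(1+z\sigma^m(c))$. (b) $gu=c$ for $u=(1-z\sigma^m(c))(1-z\sigma^{m-1}(c))\cdots(1-z\sigma(c))$; moreover $u$ is a unit of $A[z;\sigma]$ and $u=1-z\big(\sigma(c)+\dots+\sigma^m(c)\big)$. (c) $\mathcal C=\mathfrak v(\{fg\mid f\in A[z;\sigma]\})$. Thus $\mathcal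 C$ is $\sigma$-cyclic, i.e. $\mathfrak v^{-1}(\mathcal C)$ is a left ideal of $A[z;\sigma]$. Moreover $\operatorname{rank}_{\mathbb F[z]}\mathcal C=k$. (d) $\mathcal C$ is a direct summand of $\mathbb F[z]^n$, and $G$ is right invertible over $\mathbb F[z]$; so $\mathcal C$ is a $\sigma$-cyclic convolutional code. (e) $G$ is minimal: it has rank $k$, and the maximal degree of its $k\times k$ minors (its overall constraint length) equals the sum of its row degrees, where the degree of a polynomial row vector is the maximal degree of its entries. (f) $\mathcal C$ is a convolutional code with parameters $(n,k,km)$, i.e. the row module of a right invertible $k\times n$ matrix over $\mathbb F[z]$ with overall constraint length $km$. All $k$ Forney indices of $\mathcal C$ (the row degrees of any minimal matrix with row module $\mathcal C$) are equal to $m$; in particular its memory, the largest Forney index, is $m$. -/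

import Mathlib

open Polynomial

noncomputable section

namespace DoublyCyclicCode

/-! ### The Piret algebra `A[z;σ]` -/

section Piret

variable {F A : Type*} [Field F] [CommRing A] [Algebra F A]

/-- The action of the monoid `ℕ` on `A` through the powers of `σ⁻¹`. -/
@[reducible] def twistAction (σ : A ≃ₐ[F] A) : MulSemiringAction (Multiplicative ℕ) A :=
  MulSemiringAction.compHom A (powersHom (A ≃ₐ[F] A) σ⁻¹)

/-- The skew polynomial ring `A[z;σ]` with the multiplication rule `a z = z σ(a)`.
Mathlib's skew polynomials obey the rule `z a = φ(a) z`, so here `φ = σ⁻¹`;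
see `PiretAlgebra.coe_mul_z`. -/
def PiretAlgebra (_σ : A ≃ₐ[F] A) : Type _ := SkewPolynomial A

namespace PiretAlgebra

variable (σ : A ≃ₐ[F] A)

instance : Ring (PiretAlgebra σ) :=
  letI := twistAction σ
  inferInstanceAs (Ring (SkewPolynomial A))

/-- The embedding of `A` into `A[z;σ]` as constants. -/
def ι : A →+* PiretAlgebra σ :=
  letI := twistAction σ
  SkewPolynomial.CRingHom

/-- The indeterminate `z`. -/
def z : PiretAlgebra σ := (SkewPolynomial.X : SkewPolynomial A)

theorem phi_iterate (k : ℕ) (a : A) :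
    (letI := twistAction σ; (SkewPolynomial.φ (R := A))^[k] a) = (σ⁻¹ ^ k) a := by
  let := twistAction σ
  rw [SkewPolynomial.φ_iterate_apply]
  rfl

/-- The defining rule `a z = z σ(a)`. -/
theorem coe_mul_z (a : A) : ι σ a * z σ = z σ * ι σ (σ a) := by
  let := twistAction σ
  have h := phi_iterate σ 1 (σ a)
  have h1 : (SkewPolynomial.C a : SkewPolynomial A) * SkewPolynomial.monomial 1 1
      = SkewPolynomial.monomial 1 1 * SkewPolynomial.C (σ a) := by
    rw [SkewPolynomial.C_mul_monomial, SkewPolynomial.monomial_mul_C, h]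
    simp
  exact h1

theorem z_pow_mul_coe (k : ℕ) (a : A) :
    z σ ^ k * ι σ a = (SkewPolynomial.monomial k ((σ⁻¹ ^ k) a) : SkewPolynomial A) := by
  let := twistAction σ
  have h1 : (SkewPolynomial.X : SkewPolynomial A) ^ k * SkewPolynomial.C a
      = SkewPolynomial.monomial k ((σ⁻¹ ^ k) a) := by
    rw [← SkewPolynomial.monomial_one_right_eq_X_pow, SkewPolynomial.monomial_mul_C,
      phi_iterate, one_mul]
  exact h1

/-- The embedding of the commutative polynomial ring `F[z]` into `A[z;σ]`. -/
def polyHom : F[X] →+* PiretAlgebra σ :=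
  Polynomial.eval₂RingHom' ((ι σ).comp (algebraMap F A)) (z σ) fun a => by
    change ι σ (algebraMap F A a) * z σ = z σ * ι σ (algebraMap F A a)
    rw [coe_mul_z, AlgEquiv.commutes]

/-- `A[z;σ]` as a left `F[z]`-module, through left multiplication. -/
instance : Module F[X] (PiretAlgebra σ) := Module.compHom _ (polyHom σ)

theorem smul_def (f : F[X]) (h : PiretAlgebra σ) : f • h = polyHom σ f * h := rfl

end PiretAlgebra

end Piret

/-! ### The algebra `A = F[x]/⟨xⁿ - 1⟩` and the maps `𝔭` and `𝔳` -/

section Cyclic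

variable (F : Type*) [Field F] (n : ℕ)

/-- `A = F[x]/⟨xⁿ - 1⟩`. -/
abbrev CyclicAlgebra : Type _ := AdjoinRoot (X ^ n - 1 : F[X])

/-- The class of `x` in `A`. -/
abbrev CyclicAlgebra.x : CyclicAlgebra F n := AdjoinRoot.root (X ^ n - 1 : F[X])

/-- The linear map `Fⁿ → A`, `(v₀, …, vₙ₋₁) ↦ ∑ vᵢ xⁱ`. -/
def pLin₀ : (Fin n → F) →ₗ[F] CyclicAlgebra F n :=
  Fintype.linearCombination F fun i : Fin n => CyclicAlgebra.x F n ^ (i : ℕ)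

theorem pLin₀_bijective [NeZero n] : Function.Bijective (pLin₀ F n) := by
  have hm : (X ^ n - 1 : F[X]).Monic := by
    simpa using monic_X_pow_sub_C (1 : F) (NeZero.ne n)
  have hd : (X ^ n - 1 : F[X]).natDegree = n := by
    simpa using natDegree_X_pow_sub_C (n := n) (r := (1 : F))
  have hpd : (AdjoinRoot.powerBasis' hm).dim = n := hd
  let B := (AdjoinRoot.powerBasis' hm).basis.reindex (finCongr hpd)
  have hB : (B.equivFun.symm : (Fin n → F) →ₗ[F] CyclicAlgebra F n) = pLin₀ F n := by
    ext i
    simp [B, pLin₀, Fintype.linearCombination_apply, Pi.single_apply]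
  rw [← hB]
  exact B.equivFun.symm.bijective

/-- The isomorphism `𝔭 : Fⁿ → A`, `(v₀, …, vₙ₋₁) ↦ ∑ vᵢ xⁱ`. -/
def p₀ [NeZero n] : (Fin n → F) ≃ₗ[F] CyclicAlgebra F n :=
  LinearEquiv.ofBijective (pLin₀ F n) (pLin₀_bijective F n)

theorem p₀_apply [NeZero n] (v : Fin n → F) :
    p₀ F n v = ∑ i : Fin n, v i • CyclicAlgebra.x F n ^ (i : ℕ) := rfl

/-- The coordinate map `𝔳 = 𝔭⁻¹ : A → Fⁿ`. -/
def v₀ [NeZero n] : CyclicAlgebra F n ≃ₗ[F] (Fin n → F) := (p₀ F n).symm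

variable {F n}
variable (σ : CyclicAlgebra F n ≃ₐ[F] CyclicAlgebra F n)

/-- The `F[z]`-linear map `F[z]ⁿ → A[z;σ]`, `(w₀, …, wₙ₋₁) ↦ ∑ wᵢ xⁱ`. -/
def pLin : (Fin n → F[X]) →ₗ[F[X]] PiretAlgebra σ :=
  Fintype.linearCombination F[X] fun i : Fin n =>
    PiretAlgebra.ι σ (CyclicAlgebra.x F n ^ (i : ℕ))

/-- Coefficients stand to the right of `z`: `𝔭(z^ν v) = z^ν 𝔭(v)` for `v ∈ Fⁿ`. -/
theorem pLin_monomial [NeZero n] (k : ℕ) (v : Fin n → F) :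
    pLin σ (fun i => monomial k (v i)) = PiretAlgebra.z σ ^ k * PiretAlgebra.ι σ (p₀ F n v) := by
  rw [pLin, Fintype.linearCombination_apply, p₀_apply, map_sum, Finset.mul_sum]
  refine Finset.sum_congr rfl fun i _ => ?_
  rw [PiretAlgebra.smul_def, ← C_mul_X_pow_eq_monomial, ← X_pow_mul, map_mul, map_pow, mul_assoc,
    Algebra.smul_def, map_mul]
  simp [PiretAlgebra.polyHom]

theorem pLin_coeff [NeZero n] (w : Fin n → F[X]) (k : ℕ) :
    SkewPolynomial.coeff (pLin σ w : SkewPolynomial (CyclicAlgebra F n)) k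
      = (σ⁻¹ ^ k) (p₀ F n fun i => (w i).coeff k) := by
  let L₁ : (Fin n → F[X]) →+ CyclicAlgebra F n :=
    { toFun := fun w => SkewPolynomial.coeff
        (pLin σ w : SkewPolynomial (CyclicAlgebra F n)) k
      map_zero' := by rw [map_zero]; rfl
      map_add' := fun a b => by rw [map_add]; exact SkewPolynomial.coeff_add _ _ _ }
  let L₂ : (Fin n → F[X]) →+ CyclicAlgebra F n :=
    { toFun := fun w => (σ⁻¹ ^ k) (p₀ F n fun i => (w i).coeff k)
      map_zero' := by
        have : (fun i : Fin n => ((0 : Fin n → F[X]) i).coeff k) = 0 := by ext; simp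
        rw [this, map_zero, map_zero]
      map_add' := fun a b => by
        rw [← map_add, ← map_add]
        refine congrArg _ (congrArg _ ?_)
        ext i
        simp }
  suffices h : L₁ = L₂ from DFunLike.congr_fun h w
  refine AddMonoidHom.functions_ext' _ _ _ ?_
  intro i
  ext j a
  change SkewPolynomial.coeff (pLin σ (Pi.single i (monomial j a)) :
      SkewPolynomial (CyclicAlgebra F n)) k
    = (σ⁻¹ ^ k) (p₀ F n fun l => ((Pi.single i (monomial j a) : Fin n → F[X]) l).coeff k)
  have hs : (Pi.single i (monomial j a) : Fin n → F[X])
      = fun l => monomial j ((Pi.single i a : Fin n → F) l) := by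
    ext l : 1
    by_cases hl : l = i
    · subst hl; simp
    · simp [hl]
  rw [hs, pLin_monomial, PiretAlgebra.z_pow_mul_coe, SkewPolynomial.coeff_monomial]
  split_ifs with hjk
  · subst hjk
    simp
  · have : (fun l => (monomial j ((Pi.single i a : Fin n → F) l)).coeff k) = 0 := by
      ext l; simp [coeff_monomial, hjk]
    rw [this, map_zero, map_zero]

theorem pLin_bijective [NeZero n] : Function.Bijective (pLin σ) := by
  constructor
  · rw [injective_iff_map_eq_zero]
    intro w hw
    have h : ∀ k, (fun i => (w i).coeff k) = 0 := by
      intro k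
      have h1 := pLin_coeff σ w k
      rw [hw] at h1
      have h2 : (0 : CyclicAlgebra F n) = (σ⁻¹ ^ k) (p₀ F n fun i => (w i).coeff k) := h1
      simpa using h2.symm
    ext i k
    simpa using congrFun (h k) i
  · intro f
    rw [← LinearMap.mem_range]
    refine SkewPolynomial.induction (motive := fun f => (f : PiretAlgebra σ) ∈ LinearMap.range (pLin σ))
      f (Submodule.zero_mem _) ?_
    intro k a q _ _ hq
    refine Submodule.add_mem _ ⟨fun i => monomial k (v₀ F n ((σ ^ k) a) i), ?_⟩ hq
    rw [pLin_monomial, PiretAlgebra.z_pow_mul_coe]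
    have h : (σ⁻¹ ^ k) (p₀ F n fun i => v₀ F n ((σ ^ k) a) i) = a := by
      change (σ⁻¹ ^ k) (p₀ F n ((p₀ F n).symm ((σ ^ k) a))) = a
      rw [LinearEquiv.apply_symm_apply, ← AlgEquiv.mul_apply, inv_pow, inv_mul_cancel]
      rfl
    rw [h]

/-- The isomorphism of left `F[z]`-modules `𝔭 : F[z]ⁿ → A[z;σ]`,
`∑ z^ν v_ν ↦ ∑ z^ν 𝔭(v_ν)` for `v_ν ∈ Fⁿ`. -/
def p [NeZero n] : (Fin n → F[X]) ≃ₗ[F[X]] PiretAlgebra σ :=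
  LinearEquiv.ofBijective (pLin σ) (pLin_bijective σ)

/-- The isomorphism `𝔳 = 𝔭⁻¹ : A[z;σ] → F[z]ⁿ`. -/
def v [NeZero n] : PiretAlgebra σ ≃ₗ[F[X]] (Fin n → F[X]) := (p σ).symm

end Cyclic

/-! ### Convolutional codes -/

section Codes

variable {F : Type*} [Field F] {k n : ℕ}

/-- `im G = {w G | w ∈ F[z]^k}`, the row module of `G`. -/
def im (G : Matrix (Fin k) (Fin n) F[X]) : Submodule F[X] (Fin n → F[X]) :=
  LinearMap.range G.vecMulLinear

/-- `G` is right invertible over `F[z]`. -/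
def RightInvertible (G : Matrix (Fin k) (Fin n) F[X]) : Prop :=
  ∃ H : Matrix (Fin n) (Fin k) F[X], G * H = 1

/-- The overall constraint length: the maximal degree of the `k`-minors of `G`
(the zero polynomial has degree `⊥`). -/
def overallConstraintLength (G : Matrix (Fin k) (Fin n) F[X]) : WithBot ℕ :=
  Finset.univ.sup fun f : Fin k ↪o Fin n => (G.submatrix id f).det.degree

/-- The degree of a polynomial vector: the maximal degree of its components. -/
def vecDegree (w : Fin n → F[X]) : WithBot ℕ := Finset.univ.sup fun j => (w j).degree

/-- `C ⊆ F[z]ⁿ` is a convolutional code with parameters `(n, k, δ)`. -/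
def IsConvolutionalCode (C : Submodule F[X] (Fin n → F[X])) (k δ : ℕ) : Prop :=
  ∃ G : Matrix (Fin k) (Fin n) F[X],
    RightInvertible G ∧ C = im G ∧ overallConstraintLength G = δ

/-- `G ∈ F[z]^{k×n}` has rank `k` and its overall constraint length is the sum of its
row degrees. -/
def IsMinimal (G : Matrix (Fin k) (Fin n) F[X]) : Prop :=
  G.rank = k ∧ overallConstraintLength G = ∑ i, vecDegree (G i)

/-- `ν` is the multiset of Forney indices of `C`: the row degrees of a minimal matrix
with row module `C`. -/
def IsForneyIndices (C : Submodule F[X] (Fin n → F[X])) (ν : Multiset (WithBot ℕ)) : Prop :=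
  ∃ (k : ℕ) (G : Matrix (Fin k) (Fin n) F[X]),
    IsMinimal G ∧ im G = C ∧ ν = Finset.univ.val.map fun i => vecDegree (G i)

/-- `μ` is the memory of `C`: its largest Forney index. -/
def IsMemory (C : Submodule F[X] (Fin n → F[X])) (μ : ℕ) : Prop :=
  ∃ ν, IsForneyIndices C ν ∧ IsGreatest {d | d ∈ ν} (μ : WithBot ℕ)

/-- `C` is `σ`-cyclic: `𝔭(C)` is a left ideal of `A[z;σ]`
(`Ideal` means left ideal in a noncommutative ring). -/
def IsSigmaCyclic [NeZero n] (σ : CyclicAlgebra F n ≃ₐ[F] CyclicAlgebra F n)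
    (C : Submodule F[X] (Fin n → F[X])) : Prop :=
  ∃ I : Ideal (PiretAlgebra σ), (I : Set (PiretAlgebra σ)) = p σ '' C

end Codes

/-! ### Primitive idempotents and doubly-cyclic codes -/

section DoublyCyclic

variable (F : Type*) [Field F] (n : ℕ)

/-- The monic prime factors of `xⁿ - 1`. -/
def primeFactors : Set F[X] := {π | π.Monic ∧ Irreducible π ∧ π ∣ X ^ n - 1}

/-- The set `E` of the primitive idempotents of `A`: those `ε` such that, for some prime
factor `π` of `xⁿ - 1`, `ε ≡ 1 mod π` and `ε ≡ 0 mod π'` for all other prime factors `π'`. -/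
def primitiveIdempotents : Set (CyclicAlgebra F n) :=
  {ε | ∃ π ∈ primeFactors F n, AdjoinRoot.mk (X ^ n - 1) π ∣ ε - 1 ∧
    ∀ π' ∈ primeFactors F n, π' ≠ π → AdjoinRoot.mk (X ^ n - 1) π' ∣ ε}

variable {F n}

/-- `k = dim_F ⟨c⟩`, the dimension of the cyclic block code generated by `c`. -/
def blockDim (c : CyclicAlgebra F n) : ℕ :=
  Module.finrank F ((Ideal.span {c}).restrictScalars F)

variable (σ : CyclicAlgebra F n ≃ₐ[F] CyclicAlgebra F n) (c : CyclicAlgebra F n)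

/-- The matrix `G_ν ∈ F^{k×n}` with rows `𝔳(σ^ν(xⁱ c))`, `0 ≤ i < k`. -/
def coeffMatrix [NeZero n] (ν : ℕ) : Matrix (Fin (blockDim c)) (Fin n) F :=
  Matrix.of fun i => v₀ F n ((σ ^ ν) (CyclicAlgebra.x F n ^ (i : ℕ) * c))

/-- `G = ∑_{ν=0}^m z^ν G_ν ∈ F[z]^{k×n}`. -/
def genMatrix [NeZero n] (m : ℕ) : Matrix (Fin (blockDim c)) (Fin n) F[X] :=
  ∑ ν ∈ Finset.range (m + 1), (X ^ ν : F[X]) • (coeffMatrix σ c ν).map C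

/-- `g = ∑_{ν=0}^m z^ν σ^ν(c) ∈ A[z;σ]`. -/
def genPoly (m : ℕ) : PiretAlgebra σ :=
  ∑ ν ∈ Finset.range (m + 1), PiretAlgebra.z σ ^ ν * PiretAlgebra.ι σ ((σ ^ ν) c)

/-- `u = (1 - zσ^m(c))(1 - zσ^{m-1}(c))⋯(1 - zσ(c)) ∈ A[z;σ]`. -/
def genUnit (m : ℕ) : PiretAlgebra σ :=
  ((List.range' 1 m).reverse.map fun ν =>
    1 - PiretAlgebra.z σ * PiretAlgebra.ι σ ((σ ^ ν) c)).prod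

end DoublyCyclic

end DoublyCyclicCode

end

open DoublyCyclicCode

open DoublyCyclicCode

/-! Since `n` is nonzero in `F`, `xⁿ - 1` is squarefree, so an element of `A` vanishes once every
prime factor divides it. Hence primitive idempotents are minimal, and distinct ones are orthogonal.
Automorphisms preserve minimality, so `c` is idempotent and disjointness gives `c * σ^j(c) = 0` for
`1 ≤ j ≤ b`; thus `σ^i(c)` and `σ^j(c)` are orthogonal whenever `0 < |i - j| ≤ b`.

Because `zσ^i(c) · zσ^j(c) = z²σ^(i+1)(c)σ^j(c)`, within this range of indices only consecutive
increasing factors interact. The increasing product of the `1 + zσ^ν(c)`, multiplied on the left by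
`c`, therefore collapses to `g`, and the decreasing product `u` is linear in `z`. Each `zσ^ν(c)`
squares to zero, so the factors of `u` invert those of `g` and `gu = c`.

Row `i` of `G` corresponds to `xⁱg`. As `cg = g` and the shifts `xⁱc`, `i < k`, form a basis of
`⟨c⟩`, the row module is the left ideal of `g` (`im_genMatrix_eq`). Right multiplication by `u` is
`F[z]`-linear and turns `G` into the constant full-rank matrix `G₀`, whence right invertibility
(`rightInvertible_genMatrix`).

All rows have degree `m`, and the leading matrix `G_m` also has full rank because `σ^m` is
injective. So some maximal minor has degree `km`, and no nonzero codeword has degree below `m`. The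
row degrees of any minimal matrix are thus at least `m` with sum `km`, hence all equal to `m`
(`vecDegree_eq_of_isMinimal`). -/

namespace DoublyCyclicCode

open Polynomial

/-! ### Polynomial matrices with a full-rank leading coefficient matrix -/

section Matrices

/-- A matrix over a field with linearly independent rows has a nonzero maximal minor. -/
theorem exists_submatrix_det_ne_zero {K : Type*} [Field K] {k n : ℕ}
    {M : Matrix (Fin k) (Fin n) K} (hM : LinearIndependent K M.row) :
    ∃ f : Fin k ↪o Fin n, (M.submatrix id f).det ≠ 0 := by
  classical
  obtain ⟨κ, a, ha, hspan, hli⟩ := exists_linearIndependent' K M.col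
  have : Fintype κ := Fintype.ofInjective a ha
  have hcard : Fintype.card κ = k := by
    rw [← finrank_span_eq_card hli, hspan, ← Matrix.rank_eq_finrank_span_cols, hM.rank_matrix,
      Fintype.card_fin]
  have hs : (Finset.univ.image a).card = k := by
    rw [Finset.card_image_of_injective _ ha, Finset.card_univ, hcard]
  -- Minors are indexed by order embeddings, so the chosen columns are listed increasingly; `g`
  -- records the reordering.
  let f := (Finset.univ.image a).orderEmbOfFin hs
  have hf : ∀ i, ∃ j, a j = f i := fun i => by
    have := Finset.orderEmbOfFin_mem (Finset.univ.image a) hs i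
    obtain ⟨j, -, hj⟩ := Finset.mem_image.mp this
    exact ⟨j, hj⟩
  choose g hg using hf
  have hginj : Function.Injective g := fun i j hij => f.injective (by rw [← hg, ← hg, hij])
  refine ⟨f, ?_⟩
  have h1 : LinearIndependent K (M.submatrix id f).col := by
    have h2 := hli.comp g hginj
    have h3 : (M.col ∘ a) ∘ g = (M.submatrix id f).col := by
      funext i
      simp only [Function.comp, hg]
      rfl
    rwa [h3] at h2
  exact ((Matrix.isUnit_iff_isUnit_det _).mp
    (Matrix.linearIndependent_cols_iff_isUnit.mp h1)).ne_zero

theorem exists_mul_eq_one {K : Type*} [Field K] {k n : ℕ} {M : Matrix (Fin k) (Fin n) K}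
    (hM : LinearIndependent K M.row) : ∃ H : Matrix (Fin n) (Fin k) K, M * H = 1 := by
  rw [← Matrix.mulVec_surjective_iff_exists_right_inverse, ← Matrix.coe_mulVecLin,
    ← LinearMap.range_eq_top]
  apply Submodule.eq_top_of_finrank_eq
  rw [Module.finrank_fin_fun]
  exact hM.rank_matrix.trans (Fintype.card_fin k)

theorem natDegree_det_le {R : Type*} [CommRing R] {k m : ℕ} (M : Matrix (Fin k) (Fin k) R[X])
    (hM : ∀ i j, (M i j).natDegree ≤ m) : M.det.natDegree ≤ k * m := by
  rw [Matrix.det_apply]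
  refine natDegree_sum_le_of_forall_le _ _ fun τ _ => ?_
  refine (natDegree_smul_le _ _).trans ((natDegree_prod_le _ _).trans ?_)
  refine (Finset.sum_le_card_nsmul _ _ m fun i _ => hM _ _).trans ?_
  simp

/-- Each Leibniz term is a product of `k` entries of degree at most `m`, so its top coefficient is
the product of theirs. -/
theorem coeff_det {R : Type*} [CommRing R] {k m : ℕ} (M : Matrix (Fin k) (Fin k) R[X])
    (hM : ∀ i j, (M i j).natDegree ≤ m) :
    M.det.coeff (k * m) = (M.map fun q => q.coeff m).det := by
  rw [Matrix.det_apply, Matrix.det_apply, finsetSum_coeff]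
  refine Finset.sum_congr rfl fun τ _ => ?_
  rw [coeff_smul]
  congr 1
  have := coeff_prod_of_natDegree_le Finset.univ (fun i => M (τ i) i) m fun i _ => hM _ _
  simpa using this

variable {F : Type*} [Field F] {k n m : ℕ} {G : Matrix (Fin k) (Fin n) F[X]}

/-- Allows the right inverse to be built as a composite of linear maps passing through `A[z;σ]`. -/
theorem rightInvertible_of_linearMap (L : (Fin n → F[X]) →ₗ[F[X]] (Fin k → F[X]))
    (hL : ∀ i, L (G i) = Pi.single i 1) :
    RightInvertible G := by
  refine ⟨(LinearMap.toMatrix' L).transpose, ?_⟩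
  funext i
  have h1 : (G * (LinearMap.toMatrix' L).transpose) i = L (G i) := by
    rw [Matrix.mul_apply_eq_vecMul, Matrix.vecMul_transpose, LinearMap.toMatrix'_mulVec]
  rw [h1, hL]
  funext j
  simp [Matrix.one_apply, Pi.single_apply, eq_comm]

theorem RightInvertible.rank_eq (hG : RightInvertible G) : G.rank = k := by
  obtain ⟨H, hH⟩ := hG
  refine le_antisymm G.rank_le_height ?_
  have := Matrix.rank_mul_le_left G H
  rwa [hH, Matrix.rank_one, Fintype.card_fin] at this

theorem RightInvertible.vecMul_injective (hG : RightInvertible G) :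
    Function.Injective G.vecMulLinear := by
  obtain ⟨H, hH⟩ := hG
  refine Function.LeftInverse.injective (g := H.vecMulLinear) fun w => ?_
  simp [Matrix.vecMul_vecMul, hH]

theorem RightInvertible.finrank_im (hG : RightInvertible G) :
    Module.finrank F[X] (im G) = k := by
  rw [im, LinearMap.finrank_range_of_inj hG.vecMul_injective, Module.finrank_fin_fun]

theorem RightInvertible.exists_isCompl (hG : RightInvertible G) :
    ∃ D : Submodule F[X] (Fin n → F[X]), IsCompl (im G) D := by
  obtain ⟨H, hH⟩ := hG
  refine ⟨_, LinearMap.isCompl_of_proj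
    (f := G.vecMulLinear.rangeRestrict ∘ₗ H.vecMulLinear) ?_⟩
  rintro ⟨_, w, rfl⟩
  ext1
  simp [Matrix.vecMul_vecMul, hH]

theorem row_mem_im (G : Matrix (Fin k) (Fin n) F[X]) (i : Fin k) : G i ∈ im G :=
  ⟨Pi.single i 1, by simp [Matrix.row]⟩

theorem mem_im_iff_exists {w : Fin n → F[X]} :
    w ∈ im G ↔ ∃ a : Fin k → F[X], Matrix.vecMul a G = w := Iff.rfl

theorem vecDegree_eq (hdeg : ∀ i j, (G i j).natDegree ≤ m)
    (hlead : LinearIndependent F (G.map fun q => q.coeff m).row) (i : Fin k) :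
    vecDegree (G i) = m := by
  refine le_antisymm (Finset.sup_le fun j _ => natDegree_le_iff_degree_le.mp (hdeg i j)) ?_
  obtain ⟨j, hj⟩ := Function.ne_iff.mp (hlead.ne_zero i)
  exact (le_degree_of_ne_zero hj).trans (Finset.le_sup (f := fun j => (G i j).degree)
    (Finset.mem_univ j))

theorem overallConstraintLength_eq (hdeg : ∀ i j, (G i j).natDegree ≤ m)
    (hlead : LinearIndependent F (G.map fun q => q.coeff m).row) :
    overallConstraintLength G = (k * m : ℕ) := by
  refine le_antisymm (Finset.sup_le fun f _ => natDegree_le_iff_degree_le.mp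
    (natDegree_det_le _ fun i j => hdeg _ _)) ?_
  obtain ⟨f, hf⟩ := exists_submatrix_det_ne_zero hlead
  refine le_trans (le_degree_of_ne_zero ?_) (Finset.le_sup (f := fun f : Fin k ↪o Fin n =>
    (G.submatrix id f).det.degree) (Finset.mem_univ f))
  rw [coeff_det (G.submatrix id f) fun i j => hdeg _ _]
  exact hf

theorem isMinimal_of_leading (hG : RightInvertible G) (hdeg : ∀ i j, (G i j).natDegree ≤ m)
    (hlead : LinearIndependent F (G.map fun q => q.coeff m).row) : IsMinimal G := by
  refine ⟨hG.rank_eq, ?_⟩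
  rw [overallConstraintLength_eq hdeg hlead]
  simp [vecDegree_eq hdeg hlead]

/-- Every nonzero vector in the row module has degree at least `m`. -/
theorem le_vecDegree_vecMul (hdeg : ∀ i j, (G i j).natDegree ≤ m)
    (hlead : LinearIndependent F (G.map fun q => q.coeff m).row) {w : Fin k → F[X]}
    (hw : w ≠ 0) : (m : WithBot ℕ) ≤ vecDegree (Matrix.vecMul w G) := by
  let d := Finset.univ.sup fun i => (w i).natDegree
  have hd : ∀ i, (w i).natDegree ≤ d := fun i =>
    Finset.le_sup (f := fun i => (w i).natDegree) (Finset.mem_univ i)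
  have hne : (fun i => (w i).coeff d) ≠ 0 := by
    obtain ⟨i₀, hi₀⟩ := Function.ne_iff.mp hw
    obtain ⟨i, -, hi⟩ := Finset.exists_mem_eq_sup Finset.univ ⟨i₀, Finset.mem_univ _⟩
      fun i => (w i).natDegree
    intro h
    -- The maximum may be attained at a zero entry, whose `natDegree` is `0`; then `d = 0` and the
    -- nonzero entry `w i₀` is a constant.
    by_cases hwi : w i = 0
    · have hd0 : d = 0 := by rw [show d = (w i).natDegree from hi, hwi, natDegree_zero]
      have h0 := eq_C_of_natDegree_le_zero ((hd i₀).trans hd0.le)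
      have h1 : (w i₀).coeff d = 0 := congrFun h i₀
      rw [hd0] at h1
      rw [h1, C_0] at h0
      exact hi₀ h0
    · refine hwi (leadingCoeff_eq_zero.mp ?_)
      have h1 : (w i).coeff d = 0 := congrFun h i
      rwa [show d = (w i).natDegree from hi] at h1
  have hcoeff : (fun j => (Matrix.vecMul w G j).coeff (d + m))
      = Matrix.vecMul (fun i => (w i).coeff d) (G.map fun q => q.coeff m) := by
    funext j
    simp only [Matrix.vecMul, dotProduct, finsetSum_coeff, Matrix.map_apply]
    exact Finset.sum_congr rfl fun i _ => coeff_mul_add_eq_of_natDegree_le (hd i) (hdeg i j)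
  have hne' : Matrix.vecMul (fun i => (w i).coeff d) (G.map fun q => q.coeff m) ≠ 0 := fun h =>
    hne (Matrix.vecMul_injective_iff.mpr hlead (by simpa using h))
  obtain ⟨j, hj⟩ := Function.ne_iff.mp hne'
  rw [← hcoeff] at hj
  have h1 : (m : WithBot ℕ) ≤ ((d + m : ℕ) : WithBot ℕ) := by exact_mod_cast Nat.le_add_left m d
  exact h1.trans ((le_degree_of_ne_zero hj).trans
    (Finset.le_sup (f := fun j => (Matrix.vecMul w G j).degree) (Finset.mem_univ j)))

theorem exists_mul_eq_of_im_le {k' : ℕ} {G' : Matrix (Fin k') (Fin n) F[X]}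
    (h : im G' ≤ im G) : ∃ U : Matrix (Fin k') (Fin k) F[X], U * G = G' := by
  choose U hU using fun i => mem_im_iff_exists.mp (h (row_mem_im G' i))
  exact ⟨Matrix.of U, funext hU⟩

theorem overallConstraintLength_mul {U : Matrix (Fin k) (Fin k) F[X]} (hU : IsUnit U.det) :
    overallConstraintLength (U * G) = overallConstraintLength G := by
  refine Finset.sup_congr rfl fun f _ => ?_
  have : (U * G).submatrix id f = U * G.submatrix id f := by
    simpa using Matrix.submatrix_mul U G id id f Function.bijective_id
  rw [this, Matrix.det_mul, degree_mul, degree_eq_zero_of_isUnit hU, zero_add]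

/-- The two matrices differ by a unimodular factor, which preserves the overall constraint length `k
* m`. Every row degree is at least `m`, and by minimality they sum to `k * m`, which forces
equality. -/
theorem vecDegree_eq_of_isMinimal (hG : RightInvertible G)
    (hdeg : ∀ i j, (G i j).natDegree ≤ m)
    (hlead : LinearIndependent F (G.map fun q => q.coeff m).row)
    {G' : Matrix (Fin k) (Fin n) F[X]} (hmin : IsMinimal G') (him : im G' = im G) (i : Fin k) :
    vecDegree (G' i) = m := by
  obtain ⟨U, rfl⟩ := exists_mul_eq_of_im_le him.le
  obtain ⟨V, hV⟩ := exists_mul_eq_of_im_le him.ge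
  have hVU : V * U = 1 := by
    obtain ⟨H, hH⟩ := hG
    have := congrArg (· * H) hV
    simpa only [Matrix.mul_assoc, hH, Matrix.mul_one] using this
  have hU : IsUnit U.det := by
    refine IsUnit.of_mul_eq_one_right V.det ?_
    rw [← Matrix.det_mul, hVU, Matrix.det_one]
  have hrow : ∀ i, (m : WithBot ℕ) ≤ vecDegree ((U * G) i) := fun i =>
    le_vecDegree_vecMul hdeg hlead (w := U i) fun h0 =>
      hU.ne_zero (Matrix.det_eq_zero_of_row_eq_zero i fun j => congrFun h0 j)
  -- The lower bound excludes the degree `⊥`, so the sums can be compared in `ℕ`.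
  have hnat : ∀ i, ∃ d : ℕ, vecDegree ((U * G) i) = d := fun i => by
    have hne : vecDegree ((U * G) i) ≠ ⊥ := fun h => by
      have := hrow i
      rw [h] at this
      exact WithBot.coe_ne_bot (le_bot_iff.mp this)
    exact ⟨_, (WithBot.coe_unbot _ hne).symm⟩
  choose d hd using hnat
  have hle : ∀ i ∈ Finset.univ, m ≤ d i := fun i _ => by
    have := hrow i
    rw [hd] at this
    exact_mod_cast this
  have hsum := hmin.2
  rw [overallConstraintLength_mul hU, overallConstraintLength_eq hdeg hlead] at hsum
  simp only [hd] at hsum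
  have hsum' : ∑ _i : Fin k, m = ∑ i, d i := by
    simp only [Finset.sum_const, Finset.card_univ, Fintype.card_fin, smul_eq_mul]
    exact_mod_cast hsum
  rw [hd, (Finset.sum_eq_sum_iff_of_le hle).mp hsum' i (Finset.mem_univ i)]

theorem isForneyIndices_iff (hG : RightInvertible G) (hdeg : ∀ i j, (G i j).natDegree ≤ m)
    (hlead : LinearIndependent F (G.map fun q => q.coeff m).row) (ν : Multiset (WithBot ℕ)) :
    IsForneyIndices (im G) ν ↔ ν = Multiset.replicate k (m : WithBot ℕ) := by
  constructor
  · rintro ⟨k', G', hmin, him, rfl⟩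
    have hkk : k' = k := by
      obtain ⟨U, hU⟩ := exists_mul_eq_of_im_le him.le
      obtain ⟨V, hV⟩ := exists_mul_eq_of_im_le him.ge
      apply le_antisymm
      · rw [← hmin.1, ← hU]
        exact (Matrix.rank_mul_le_left U G).trans U.rank_le_width
      · rw [← hG.rank_eq, ← hV]
        exact (Matrix.rank_mul_le_left V G').trans V.rank_le_width
    subst hkk
    simp [vecDegree_eq_of_isMinimal hG hdeg hlead hmin him]
  · rintro rfl
    exact ⟨k, G, isMinimal_of_leading hG hdeg hlead, rfl, by simp [vecDegree_eq hdeg hlead]⟩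

theorem isMemory_im (hk : 0 < k) (hG : RightInvertible G) (hdeg : ∀ i j, (G i j).natDegree ≤ m)
    (hlead : LinearIndependent F (G.map fun q => q.coeff m).row) : IsMemory (im G) m := by
  refine ⟨_, (isForneyIndices_iff hG hdeg hlead _).mpr rfl, ?_, fun d hd => ?_⟩
  · exact Multiset.mem_replicate.mpr ⟨hk.ne', rfl⟩
  · exact (Multiset.eq_of_mem_replicate hd).le

end Matrices

/-! ### Primitive idempotents -/

section Idempotents

/-- Squarefreeness makes each prime factor relatively prime to its cofactor, so the separate
divisibilities multiply. -/
theorem dvd_of_squarefree_of_forall_prime_dvd {R : Type*} [CommRing R] [IsDomain R]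
    [UniqueFactorizationMonoid R] {x y : R} (hx : Squarefree x)
    (h : ∀ q, Prime q → q ∣ x → q ∣ y) : x ∣ y := by
  induction x using UniqueFactorizationMonoid.induction_on_prime with
  | h₁ => exact absurd hx not_squarefree_zero
  | h₂ x hu => exact hu.dvd
  | h₃ a q _ hq ih =>
    have hrel := (squarefree_mul_iff.mp hx).1
    exact hrel.mul_dvd (h q hq (dvd_mul_right _ _))
      (ih (squarefree_mul_iff.mp hx).2.2 fun r hr hra => h r hr (hra.mul_left q))

variable {F : Type*} [Field F] {n : ℕ}

theorem natCast_ne_zero_of_not_ringChar_dvd (hchar : ¬ ringChar F ∣ n) : (n : F) ≠ 0 :=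
  fun h => hchar ((ringChar.spec F n).mp h)

/-- An element of `A` divisible by every prime factor of `xⁿ - 1` vanishes. -/
theorem eq_zero_of_forall_primeFactors_dvd (hchar : ¬ ringChar F ∣ n) {a : CyclicAlgebra F n}
    (h : ∀ π ∈ primeFactors F n, AdjoinRoot.mk (X ^ n - 1) π ∣ a) : a = 0 := by
  classical
  obtain ⟨f, rfl⟩ := AdjoinRoot.mk_surjective a
  rw [AdjoinRoot.mk_eq_zero]
  have hsq : Squarefree (X ^ n - 1 : F[X]) :=
    (X_pow_sub_one_separable_iff.mpr (natCast_ne_zero_of_not_ringChar_dvd hchar)).squarefree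
  refine dvd_of_squarefree_of_forall_prime_dvd hsq fun q hq hqx => ?_
  have hnd : normalize q ∣ X ^ n - 1 := normalize_dvd_iff.mpr hqx
  obtain ⟨b, hb⟩ := h (normalize q) ⟨monic_normalize hq.ne_zero,
    (associated_normalize q).irreducible hq.irreducible, hnd⟩
  obtain ⟨r, rfl⟩ := AdjoinRoot.mk_surjective b
  rw [← map_mul, AdjoinRoot.mk_eq_mk] at hb
  have h1 : normalize q ∣ f := by
    have := (hnd.trans hb).add (dvd_mul_right (normalize q) r)
    simpa using this
  exact normalize_dvd_iff.mp h1

/-- `ε` is idempotent and every multiple of it is either zero or generates the same ideal. -/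
def IsMinimalIdempotent {A : Type*} [CommRing A] (ε : A) : Prop :=
  ε * ε = ε ∧ ∀ a, a * ε = 0 ∨ ∃ b, b * (a * ε) = ε

theorem IsMinimalIdempotent.map {A : Type*} [CommRing A] {ε : A} (h : IsMinimalIdempotent ε)
    (e : A ≃+* A) : IsMinimalIdempotent (e ε) := by
  refine ⟨by rw [← map_mul, h.1], fun a => ?_⟩
  rcases h.2 (e.symm a) with h0 | ⟨b, hb⟩
  · left
    simpa using congrArg e h0
  · right
    exact ⟨e b, by simpa using congrArg e hb⟩

/-- If the product were nonzero, each idempotent would be a multiple of the other, and idempotents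
generating the same ideal coincide. -/
theorem IsMinimalIdempotent.mul_eq_zero {A : Type*} [CommRing A] {ε ε' : A}
    (h : IsMinimalIdempotent ε) (h' : IsMinimalIdempotent ε') (hne : ε ≠ ε') : ε * ε' = 0 := by
  rcases h.2 ε' with h0 | ⟨b, hb⟩
  · rwa [mul_comm]
  rcases h'.2 ε with h0' | ⟨b', hb'⟩
  · exact h0'
  refine absurd ?_ hne
  have e1 : ε * ε' = ε := by
    calc ε * ε' = b * (ε' * ε) * ε' := by rw [hb]
      _ = b * (ε' * ε' * ε) := by ring
      _ = ε := by rw [h'.1, hb]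
  have e2 : ε * ε' = ε' := by
    calc ε * ε' = ε * (b' * (ε * ε')) := by rw [hb']
      _ = b' * (ε * ε * ε') := by ring
      _ = ε' := by rw [h.1, hb']
  rw [← e1, e2]

theorem isMinimalIdempotent_of_mem (hchar : ¬ ringChar F ∣ n) {ε : CyclicAlgebra F n}
    (hε : ε ∈ primitiveIdempotents F n) : IsMinimalIdempotent ε := by
  obtain ⟨π, hπ, h1, h0⟩ := hε
  -- Modulo `π` the factor `a` vanishes, modulo every other prime factor `ε` does.
  have key : ∀ a : CyclicAlgebra F n, AdjoinRoot.mk (X ^ n - 1) π ∣ a → a * ε = 0 := by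
    intro a ha
    refine eq_zero_of_forall_primeFactors_dvd hchar fun π' hπ' => ?_
    by_cases hππ : π' = π
    · subst hππ
      exact ha.mul_right _
    · exact (h0 π' hπ' hππ).mul_left _
  refine ⟨?_, fun a => ?_⟩
  · have := key _ h1
    rwa [sub_mul, one_mul, sub_eq_zero] at this
  · obtain ⟨f, rfl⟩ := AdjoinRoot.mk_surjective a
    by_cases hf : π ∣ f
    · exact Or.inl (key _ (map_dvd _ hf))
    · right
      -- Bézout: `s` inverts `f` modulo `π`, and `ε` annihilates the multiple `r * π`.
      obtain ⟨r, s, hrs⟩ := (hπ.2.1.coprime_iff_not_dvd.mpr hf)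
      refine ⟨AdjoinRoot.mk _ s, ?_⟩
      have hk := key (AdjoinRoot.mk _ (r * π)) (map_dvd _ (dvd_mul_left _ _))
      have := congrArg (fun q => AdjoinRoot.mk (X ^ n - 1) q * ε) hrs
      simp only [map_add, add_mul, hk, zero_add, map_one, one_mul] at this
      rw [← mul_assoc, ← map_mul, this]

theorem ne_zero_of_mem_primitiveIdempotents {ε : CyclicAlgebra F n}
    (hε : ε ∈ primitiveIdempotents F n) : ε ≠ 0 := by
  rintro rfl
  obtain ⟨π, hπ, ⟨b, hb⟩, -⟩ := hε
  obtain ⟨r, rfl⟩ := AdjoinRoot.mk_surjective b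
  rw [← map_one (AdjoinRoot.mk (X ^ n - 1 : F[X])), ← map_zero (AdjoinRoot.mk (X ^ n - 1 : F[X])),
    ← map_mul, ← map_sub, AdjoinRoot.mk_eq_mk] at hb
  have h2 : π ∣ 0 - 1 := by
    have := (hπ.2.2.trans hb).add (dvd_mul_right π r)
    simpa using this
  exact hπ.2.1.not_isUnit (isUnit_of_dvd_one (by simpa using h2))

theorem sum_mul_sum_eq_self {A : Type*} [CommRing A] {S : Finset A}
    (hS : ∀ ε ∈ S, IsMinimalIdempotent ε) : (∑ ε ∈ S, ε) * ∑ ε ∈ S, ε = ∑ ε ∈ S, ε := by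
  classical
  rw [Finset.sum_mul_sum]
  refine Finset.sum_congr rfl fun ε hε => ?_
  rw [Finset.sum_eq_single_of_mem ε hε fun ε' hε' hne =>
    (hS ε hε).mul_eq_zero (hS ε' hε') hne.symm, (hS ε hε).1]

theorem sum_ne_zero {A : Type*} [CommRing A] {S : Finset A} (hne : S.Nonempty)
    (hS : ∀ ε ∈ S, IsMinimalIdempotent ε) (hS0 : ∀ ε ∈ S, ε ≠ 0) : ∑ ε ∈ S, ε ≠ 0 := by
  classical
  obtain ⟨ε, hε⟩ := hne
  intro h
  have h1 := congrArg (ε * ·) h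
  simp only [Finset.mul_sum, mul_zero] at h1
  rw [Finset.sum_eq_single_of_mem ε hε fun ε' hε' hne =>
    (hS ε hε).mul_eq_zero (hS ε' hε') hne.symm, (hS ε hε).1] at h1
  exact hS0 ε hε h1

/-- The images under `e` are again minimal idempotents, and disjointness makes them distinct from
the members of `S`. -/
theorem sum_mul_map_sum_eq_zero {A : Type*} [CommRing A] {S : Finset A}
    (hS : ∀ ε ∈ S, IsMinimalIdempotent ε) (e : A ≃+* A)
    (hdisj : Disjoint (S : Set A) (e '' (S : Set A))) :
    (∑ ε ∈ S, ε) * e (∑ ε ∈ S, ε) = 0 := by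
  rw [map_sum, Finset.sum_mul_sum]
  refine Finset.sum_eq_zero fun ε hε => Finset.sum_eq_zero fun ε' hε' => ?_
  refine (hS ε hε).mul_eq_zero ((hS ε' hε').map e) ?_
  rintro rfl
  exact Set.disjoint_left.mp hdisj hε ⟨ε', hε', rfl⟩

end Idempotents

/-! ### Identities in `A[z;σ]` -/

section PiretIdentities

variable {F A : Type*} [Field F] [CommRing A] [Algebra F A] (σ : A ≃ₐ[F] A)

theorem PiretAlgebra.coe_mul_z_pow (ν : ℕ) (a : A) :
    ι σ a * z σ ^ ν = z σ ^ ν * ι σ ((σ ^ ν) a) := by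
  induction ν with
  | zero => simp
  | succ ν ih =>
    rw [pow_succ (z σ), ← mul_assoc, ih, mul_assoc, coe_mul_z, mul_assoc, pow_succ' σ,
      AlgEquiv.mul_apply]

theorem PiretAlgebra.coe_mul_z_mul_coe (a b : A) :
    ι σ a * (z σ * ι σ b) = z σ * ι σ (σ a * b) := by
  rw [← mul_assoc, coe_mul_z, mul_assoc, map_mul]

theorem PiretAlgebra.coe_smul_eq (r : F) (a : A) :
    ι σ (r • a) = (C r : F[X]) • ι σ a := by
  rw [smul_def, Algebra.smul_def, map_mul]
  simp [polyHom]

theorem PiretAlgebra.smul_mul_eq (f : F[X]) (a b : PiretAlgebra σ) : (f • a) * b = f • (a * b) := by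
  rw [smul_def, smul_def, mul_assoc]

end PiretIdentities

/-! ### Factorization of the generator and its companion unit -/

section Generator

open PiretAlgebra

variable {F : Type*} [Field F] {n : ℕ} (σ : CyclicAlgebra F n ≃ₐ[F] CyclicAlgebra F n)
  (c : CyclicAlgebra F n)

theorem genPoly_eq_coe_mul (m : ℕ) :
    genPoly σ c m = ι σ c * ∑ ν ∈ Finset.range (m + 1), z σ ^ ν := by
  rw [genPoly, Finset.mul_sum]
  exact Finset.sum_congr rfl fun ν _ => (coe_mul_z_pow σ ν c).symm

theorem coe_mul_genPoly (m : ℕ) (a : CyclicAlgebra F n) :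
    ι σ a * genPoly σ c m = ∑ ν ∈ Finset.range (m + 1), z σ ^ ν * ι σ ((σ ^ ν) (a * c)) := by
  rw [genPoly, Finset.mul_sum]
  refine Finset.sum_congr rfl fun ν _ => ?_
  rw [← mul_assoc, coe_mul_z_pow, mul_assoc, ← map_mul, ← map_mul]

theorem coe_mul_genPoly_self (m : ℕ) (hidem : c * c = c) :
    ι σ c * genPoly σ c m = genPoly σ c m := by
  rw [coe_mul_genPoly, hidem, genPoly]

theorem genUnit_succ (m : ℕ) :
    genUnit σ c (m + 1) = (1 - z σ * ι σ ((σ ^ (m + 1)) c)) * genUnit σ c m := by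
  simp [genUnit, List.range'_concat, add_comm]

variable {σ c} {b m : ℕ}

theorem pow_mul_pow_eq_zero (horth : ∀ j, 1 ≤ j → j ≤ b → c * (σ ^ j) c = 0) {i j : ℕ}
    (hij : i < j) (hjb : j ≤ i + b) : (σ ^ i) c * (σ ^ j) c = 0 := by
  obtain ⟨d, rfl⟩ := Nat.exists_eq_add_of_le hij.le
  rw [pow_add, AlgEquiv.mul_apply, ← map_mul, horth d (by omega) (by omega), map_zero]

theorem genPoly_eq_prod (hidem : c * c = c) (horth : ∀ j, 1 ≤ j → j ≤ b → c * (σ ^ j) c = 0)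
    (hmb : m ≤ b) :
    genPoly σ c m = ι σ c * ((List.range' 1 m).map fun ν =>
      1 + z σ * ι σ ((σ ^ ν) c)).prod := by
  induction m with
  | zero => simp [genPoly]
  | succ m ih =>
    rw [List.range'_concat, List.map_append, List.prod_append, ← mul_assoc, ← ih (by omega)]
    simp only [List.map_cons, List.map_nil, List.prod_singleton, one_mul]
    rw [mul_add, mul_one, genPoly, Finset.sum_range_succ, ← genPoly, add_right_inj, genPoly,
      Finset.sum_mul]
    -- Against the new factor, the term of index `ν` yields `σ^(ν+1)(c) * σ^(m+1)(c)`, which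
    -- survives only for `ν = m`; the gap `m - ν` never exceeds `b`.
    rw [Finset.sum_eq_single_of_mem m (by simp)]
    · rw [mul_assoc, coe_mul_z_mul_coe, ← AlgEquiv.mul_apply, ← pow_succ', add_comm 1 m,
        ← map_mul, hidem, ← mul_assoc, ← pow_succ]
    · intro ν hν hne
      rw [Finset.mem_range] at hν
      rw [mul_assoc, coe_mul_z_mul_coe, ← AlgEquiv.mul_apply, ← pow_succ', add_comm 1 m,
        pow_mul_pow_eq_zero horth (by omega) (by omega), map_zero, mul_zero, mul_zero]

theorem one_add_mul_one_sub (horth : ∀ j, 1 ≤ j → j ≤ b → c * (σ ^ j) c = 0) (hb : 1 ≤ b)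
    (ν : ℕ) :
    (1 + z σ * ι σ ((σ ^ ν) c)) * (1 - z σ * ι σ ((σ ^ ν) c)) = 1 ∧
    (1 - z σ * ι σ ((σ ^ ν) c)) * (1 + z σ * ι σ ((σ ^ ν) c)) = 1 := by
  -- The square contains `σ^(ν+1)(c) * σ^ν(c)`, a gap of one, hence the need for `1 ≤ b`.
  have h : z σ * ι σ ((σ ^ ν) c) * (z σ * ι σ ((σ ^ ν) c)) = 0 := by
    rw [mul_assoc, coe_mul_z_mul_coe, ← AlgEquiv.mul_apply, ← pow_succ', mul_comm ((σ ^ (ν + 1)) c),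
      pow_mul_pow_eq_zero horth (by omega) (by omega), map_zero, mul_zero, mul_zero]
  constructor
  · rw [mul_sub, mul_one, add_mul, one_mul, h]; abel
  · rw [mul_add, mul_one, sub_mul, one_mul, h]; abel

theorem isUnit_genUnit (horth : ∀ j, 1 ≤ j → j ≤ b → c * (σ ^ j) c = 0) (hb : 1 ≤ b) :
    IsUnit (genUnit σ c m) := by
  induction m with
  | zero => simp [genUnit]
  | succ m ih =>
    rw [genUnit_succ]
    exact IsUnit.mul ⟨⟨_, _, (one_add_mul_one_sub horth hb _).2,
      (one_add_mul_one_sub horth hb _).1⟩, rfl⟩ ih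

theorem prod_mul_genUnit (horth : ∀ j, 1 ≤ j → j ≤ b → c * (σ ^ j) c = 0) (hb : 1 ≤ b) :
    ((List.range' 1 m).map fun ν => 1 + z σ * ι σ ((σ ^ ν) c)).prod * genUnit σ c m = 1 := by
  induction m with
  | zero => simp [genUnit]
  | succ m ih =>
    rw [genUnit_succ, List.range'_concat, List.map_append, List.prod_append]
    simp only [List.map_cons, List.map_nil, List.prod_singleton, one_mul, add_comm 1 m]
    rw [mul_assoc, ← mul_assoc (1 + _), (one_add_mul_one_sub horth hb _).1, one_mul, ih]

theorem genPoly_mul_genUnit (hidem : c * c = c)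
    (horth : ∀ j, 1 ≤ j → j ≤ b → c * (σ ^ j) c = 0) (hb : 1 ≤ b) (hmb : m ≤ b) :
    genPoly σ c m * genUnit σ c m = ι σ c := by
  rw [genPoly_eq_prod hidem horth hmb, mul_assoc, prod_mul_genUnit horth hb, mul_one]

theorem genUnit_eq (horth : ∀ j, 1 ≤ j → j ≤ b → c * (σ ^ j) c = 0) (hmb : m ≤ b) :
    genUnit σ c m = 1 - z σ * ι σ (∑ ν ∈ Finset.Icc 1 m, (σ ^ ν) c) := by
  induction m with
  | zero => simp [genUnit]
  | succ m ih =>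
    -- Passing `z` raises the exponent to `m + 2`; the gaps to `1, …, m` run from `2` to `m + 1 ≤
    -- b`, so all cross terms vanish.
    have h : ι σ ((σ ^ (m + 1)) c) * (z σ * ι σ (∑ ν ∈ Finset.Icc 1 m, (σ ^ ν) c)) = 0 := by
      rw [coe_mul_z_mul_coe, ← AlgEquiv.mul_apply, ← pow_succ', Finset.mul_sum,
        Finset.sum_eq_zero, map_zero, mul_zero]
      intro ν hν
      rw [Finset.mem_Icc] at hν
      rw [mul_comm, pow_mul_pow_eq_zero horth (by omega) (by omega)]
    rw [genUnit_succ, ih (by omega), Finset.sum_Icc_succ_top (by omega), map_add, mul_sub, mul_one,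
      sub_mul, one_mul, mul_assoc, h, mul_add, mul_zero]
    abel

end Generator

/-! ### The cyclic block code generated by `c` -/

section CyclicBlockCode

variable {F : Type*} [Field F] {n : ℕ}

/-- The annihilator of `c`, pulled back to `F[X]`, is principal and contains `xⁿ - 1 ≠ 0`.
Multiplication by `c` identifies `F[X]/⟨h⟩` with `⟨c⟩`, so the degree of `h` will be `blockDim c`.
-/
theorem exists_generator_annihilator [NeZero n] (c : CyclicAlgebra F n) :
    ∃ h : F[X], h ≠ 0 ∧ ∀ f : F[X], AdjoinRoot.mk (X ^ n - 1) f * c = 0 ↔ h ∣ f := by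
  let I : Ideal F[X] := Ideal.comap (AdjoinRoot.mk (X ^ n - 1))
    (LinearMap.ker (LinearMap.toSpanSingleton (CyclicAlgebra F n) (CyclicAlgebra F n) c))
  have hI : ∀ f : F[X], AdjoinRoot.mk (X ^ n - 1) f * c = 0 ↔
      Submodule.IsPrincipal.generator I ∣ f := fun f => by
    rw [← Submodule.IsPrincipal.mem_iff_generator_dvd]
    rfl
  refine ⟨Submodule.IsPrincipal.generator I, fun h0 => ?_, hI⟩
  have h1 := (hI (X ^ n - 1)).mp (by rw [AdjoinRoot.mk_self, zero_mul])
  rw [h0, zero_dvd_iff] at h1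
  exact X_pow_sub_C_ne_zero (NeZero.pos n) (1 : F) (by simpa using h1)

theorem mk_mul_mem_span {h : F[X]} (h0 : h ≠ 0) {c : CyclicAlgebra F n}
    (hh : ∀ f : F[X], AdjoinRoot.mk (X ^ n - 1) f * c = 0 ↔ h ∣ f) (f : F[X]) :
    AdjoinRoot.mk (X ^ n - 1) f * c ∈ Submodule.span F
      (Set.range fun i : Fin h.natDegree => CyclicAlgebra.x F n ^ (i : ℕ) * c) := by
  have hmod : AdjoinRoot.mk (X ^ n - 1) f * c = AdjoinRoot.mk (X ^ n - 1) (f % h) * c := by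
    rw [← sub_eq_zero, ← sub_mul, ← map_sub, hh]
    exact ⟨f / h, by rw [sub_eq_iff_eq_add]; exact (EuclideanDomain.div_add_mod f h).symm⟩
  rw [hmod]
  by_cases hf : f % h = 0
  · rw [hf, map_zero, zero_mul]
    exact Submodule.zero_mem _
  · have hlt : (f % h).natDegree < h.natDegree :=
      natDegree_lt_natDegree hf (EuclideanDomain.mod_lt f h0)
    rw [(f % h).as_sum_range_C_mul_X_pow' hlt, map_sum, Finset.sum_mul]
    refine Submodule.sum_mem _ fun i hi => ?_
    rw [map_mul, map_pow, AdjoinRoot.mk_X, AdjoinRoot.mk_C, mul_assoc, ← AdjoinRoot.algebraMap_eq,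
      ← Algebra.smul_def]
    exact Submodule.smul_mem _ _ (Submodule.subset_span ⟨⟨i, Finset.mem_range.mp hi⟩, rfl⟩)

theorem linearIndependent_pow_mul {h : F[X]} (h0 : h ≠ 0) {c : CyclicAlgebra F n}
    (hh : ∀ f : F[X], AdjoinRoot.mk (X ^ n - 1) f * c = 0 ↔ h ∣ f) :
    LinearIndependent F fun i : Fin h.natDegree => CyclicAlgebra.x F n ^ (i : ℕ) * c := by
  rw [Fintype.linearIndependent_iff]
  intro g hg i
  have h1 : AdjoinRoot.mk (X ^ n - 1) (∑ i, C (g i) * X ^ (i : ℕ)) * c = 0 := by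
    rw [← hg, map_sum, Finset.sum_mul]
    refine Finset.sum_congr rfl fun i _ => ?_
    rw [map_mul, map_pow, AdjoinRoot.mk_X, AdjoinRoot.mk_C, mul_assoc, ← AdjoinRoot.algebraMap_eq,
      ← Algebra.smul_def]
  have h2 : ∑ i, C (g i) * X ^ (i : ℕ) = 0 := by
    by_contra hne
    have hlt := degree_sum_fin_lt g
    exact absurd (degree_le_of_dvd ((hh _).mp h1) hne)
      (not_le.mpr (hlt.trans_le (degree_eq_natDegree h0).ge))
  have h3 := congrArg (fun q => coeff q (i : ℕ)) h2
  simpa [finsetSum_coeff, coeff_X_pow, ← Fin.ext_iff] using h3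

/-- The first `dim ⟨c⟩` cyclic shifts of `c` form a basis of the ideal `⟨c⟩`. -/
theorem shifts_basis [NeZero n] (c : CyclicAlgebra F n) :
    (LinearIndependent F fun i : Fin (blockDim c) => CyclicAlgebra.x F n ^ (i : ℕ) * c) ∧
    ∀ a : CyclicAlgebra F n, a * c ∈ Submodule.span F
      (Set.range fun i : Fin (blockDim c) => CyclicAlgebra.x F n ^ (i : ℕ) * c) := by
  obtain ⟨h, h0, hh⟩ := exists_generator_annihilator c
  have hspan : ∀ a : CyclicAlgebra F n, a * c ∈ Submodule.span F
      (Set.range fun i : Fin h.natDegree => CyclicAlgebra.x F n ^ (i : ℕ) * c) := fun a => by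
    obtain ⟨f, rfl⟩ := AdjoinRoot.mk_surjective a
    exact mk_mul_mem_span h0 hh f
  have heq : (Ideal.span {c}).restrictScalars F = Submodule.span F
      (Set.range fun i : Fin h.natDegree => CyclicAlgebra.x F n ^ (i : ℕ) * c) := by
    apply le_antisymm
    · intro y hy
      obtain ⟨a, rfl⟩ := Ideal.mem_span_singleton'.mp hy
      exact hspan a
    · rw [Submodule.span_le]
      rintro _ ⟨i, rfl⟩
      exact Ideal.mem_span_singleton'.mpr ⟨_, rfl⟩
  have hdim : blockDim c = h.natDegree := by
    rw [blockDim, heq, finrank_span_eq_card (linearIndependent_pow_mul h0 hh), Fintype.card_fin]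
  rw [hdim]
  exact ⟨linearIndependent_pow_mul h0 hh, hspan⟩

theorem blockDim_pos [NeZero n] {c : CyclicAlgebra F n} (hc : c ≠ 0) : 0 < blockDim c := by
  rw [Nat.pos_iff_ne_zero]
  intro h
  have h1 := (shifts_basis c).2 1
  rw [h, one_mul] at h1
  simp at h1
  exact hc h1

end CyclicBlockCode

/-! ### The generator matrix -/

section GeneratorMatrix

open PiretAlgebra

variable {F : Type*} [Field F] {n : ℕ} [NeZero n]
  (σ : CyclicAlgebra F n ≃ₐ[F] CyclicAlgebra F n) (c : CyclicAlgebra F n) (m : ℕ)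

theorem genMatrix_apply (i : Fin (blockDim c)) (j : Fin n) :
    genMatrix σ c m i j
      = ∑ ν ∈ Finset.range (m + 1), monomial ν (coeffMatrix σ c ν i j) := by
  rw [genMatrix, Matrix.sum_apply]
  refine Finset.sum_congr rfl fun ν _ => ?_
  rw [Matrix.smul_apply, Matrix.map_apply, smul_eq_mul, X_pow_mul, C_mul_X_pow_eq_monomial]

theorem natDegree_genMatrix_le (i : Fin (blockDim c)) (j : Fin n) :
    (genMatrix σ c m i j).natDegree ≤ m := by
  rw [genMatrix_apply]
  refine natDegree_sum_le_of_forall_le _ _ fun ν hν => (natDegree_monomial_le _).trans ?_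
  exact Nat.lt_succ_iff.mp (Finset.mem_range.mp hν)

theorem genMatrix_map_coeff : (genMatrix σ c m).map (fun q => q.coeff m) = coeffMatrix σ c m := by
  ext i j
  simp [genMatrix_apply, finsetSum_coeff, coeff_monomial]

/-- Both `σ ^ ν` and `v₀` are injective and `F`-linear. The case `ν = 0` gives right invertibility,
`ν = m` controls the degrees. -/
theorem linearIndependent_coeffMatrix (ν : ℕ) : LinearIndependent F (coeffMatrix σ c ν).row :=
  ((shifts_basis c).1.map' (σ ^ ν).toLinearMap (LinearMap.ker_eq_bot.mpr (σ ^ ν).injective)).map'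
    (v₀ F n : CyclicAlgebra F n →ₗ[F] Fin n → F) (v₀ F n).ker

theorem p_monomial (ν : ℕ) (a : CyclicAlgebra F n) :
    p σ (fun j => monomial ν (v₀ F n a j)) = z σ ^ ν * ι σ a := by
  have h := pLin_monomial σ ν (v₀ F n a)
  rw [v₀, LinearEquiv.apply_symm_apply] at h
  exact h

theorem v_coe (a : CyclicAlgebra F n) : v σ (ι σ a) = fun j => C (v₀ F n a j) := by
  rw [v, LinearEquiv.symm_apply_eq]
  simpa using (p_monomial σ 0 a).symm

theorem p_genMatrix_row (i : Fin (blockDim c)) :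
    p σ (genMatrix σ c m i) = ι σ (CyclicAlgebra.x F n ^ (i : ℕ)) * genPoly σ c m := by
  have h : genMatrix σ c m i = ∑ ν ∈ Finset.range (m + 1), fun j =>
      monomial ν (v₀ F n ((σ ^ ν) (CyclicAlgebra.x F n ^ (i : ℕ) * c)) j) := by
    funext j
    rw [genMatrix_apply, Finset.sum_apply]
    rfl
  rw [h, map_sum, coe_mul_genPoly]
  exact Finset.sum_congr rfl fun ν _ => p_monomial σ ν _

theorem p_mem_span_of_mem_im {w : Fin n → F[X]} (hw : w ∈ im (genMatrix σ c m)) :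
    p σ w ∈ (Ideal.span {genPoly σ c m} : Ideal (PiretAlgebra σ)) := by
  obtain ⟨a, rfl⟩ := mem_im_iff_exists.mp hw
  rw [Matrix.vecMul_eq_sum, map_sum]
  refine Ideal.sum_mem _ fun i _ => ?_
  rw [map_smul, p_genMatrix_row, smul_def, ← mul_assoc]
  exact Ideal.mul_mem_left _ _ (Ideal.mem_span_singleton_self _)

variable {c}

/-- Since `cg = g`, one has `ag = (ac)g`; expanding `ac` in the shifts `xⁱc` leaves a combination of
the `xⁱg`, which are the rows. -/
theorem coe_mul_genPoly_mem (hidem : c * c = c) (a : CyclicAlgebra F n) :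
    ι σ a * genPoly σ c m ∈ (im (genMatrix σ c m)).map (p σ : (Fin n → F[X]) →ₗ[F[X]] _) := by
  rw [← coe_mul_genPoly_self σ c m hidem, ← mul_assoc, ← map_mul]
  refine Submodule.span_induction (p := fun y _ => ι σ y * genPoly σ c m ∈
    (im (genMatrix σ c m)).map (p σ : (Fin n → F[X]) →ₗ[F[X]] _)) ?_ ?_ ?_ ?_
    ((shifts_basis c).2 a)
  · rintro _ ⟨i, rfl⟩
    rw [map_mul, mul_assoc, coe_mul_genPoly_self σ c m hidem, ← p_genMatrix_row]
    exact Submodule.mem_map_of_mem (row_mem_im _ i)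
  · rw [map_zero, zero_mul]
    exact Submodule.zero_mem _
  · intro x y _ _ hx hy
    rw [map_add, add_mul]
    exact Submodule.add_mem _ hx hy
  · intro r x _ hx
    rw [coe_smul_eq, smul_mul_eq]
    exact Submodule.smul_mem _ _ hx

theorem im_genMatrix_eq (hidem : c * c = c) :
    (im (genMatrix σ c m) : Set (Fin n → F[X])) =
      v σ '' (Ideal.span {genPoly σ c m} : Ideal (PiretAlgebra σ)) := by
  ext w
  constructor
  · exact fun hw => ⟨p σ w, p_mem_span_of_mem_im σ c m hw, (p σ).symm_apply_apply w⟩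
  · rintro ⟨y, hy, rfl⟩
    obtain ⟨f, rfl⟩ := Ideal.mem_span_singleton'.mp hy
    obtain ⟨a, rfl⟩ := (p σ).surjective f
    have hp : p σ a * genPoly σ c m ∈
        (im (genMatrix σ c m)).map (p σ : (Fin n → F[X]) →ₗ[F[X]] _) := by
      -- Coefficients from `F[z]` stand on the left of the powers of `x`, so right multiplication by
      -- `g` reduces to the products `xʲg`.
      have ha : p σ a = ∑ j, a j • ι σ (CyclicAlgebra.x F n ^ (j : ℕ)) := rfl
      rw [ha, Finset.sum_mul]
      refine Submodule.sum_mem _ fun j _ => ?_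
      rw [smul_mul_eq]
      exact Submodule.smul_mem _ _ (coe_mul_genPoly_mem σ m hidem _)
    obtain ⟨w, hw, hwp⟩ := hp
    rw [← hwp]
    have : v σ (p σ w) = w := (p σ).symm_apply_apply w
    simpa [this] using hw

theorem isSigmaCyclic_im_genMatrix (hidem : c * c = c) :
    IsSigmaCyclic σ (im (genMatrix σ c m)) := by
  refine ⟨Ideal.span {genPoly σ c m}, ?_⟩
  rw [im_genMatrix_eq σ m hidem, Set.image_image]
  simp [v]

/-- Right multiplication by `u`, as a left `F[z]`-linear map. -/
noncomputable def mulRightLin (u : PiretAlgebra σ) : PiretAlgebra σ →ₗ[F[X]] PiretAlgebra σ where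
  toFun f := f * u
  map_add' f g := add_mul f g u
  map_smul' r f := smul_mul_eq σ r f u

/-- Right multiplication by `u` sends `xⁱg` to `xⁱc`, that is, row `i` of `G` to row `i` of the
constant matrix `G₀`, which has a right inverse `H` over `F`. -/
theorem rightInvertible_genMatrix {u : PiretAlgebra σ} (hu : genPoly σ c m * u = ι σ c) :
    RightInvertible (genMatrix σ c m) := by
  obtain ⟨H, hH⟩ := exists_mul_eq_one (linearIndependent_coeffMatrix σ c 0)
  refine rightInvertible_of_linearMap ((H.map (C : F →+* F[X])).vecMulLinear ∘ₗ
    (v σ : PiretAlgebra σ →ₗ[F[X]] _) ∘ₗ mulRightLin σ u ∘ₗ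
    (p σ : (Fin n → F[X]) →ₗ[F[X]] _)) fun i => ?_
  have h1 : v σ (p σ (genMatrix σ c m i) * u) = (coeffMatrix σ c 0).map (C : F →+* F[X]) i := by
    rw [p_genMatrix_row, mul_assoc, hu, ← map_mul, v_coe]
    rfl
  change Matrix.vecMul (v σ (p σ (genMatrix σ c m i) * u)) (H.map (C : F →+* F[X])) = _
  rw [h1, ← Matrix.mul_apply_eq_vecMul, ← Matrix.map_mul, hH]
  funext j
  simp [Matrix.one_apply, Pi.single_apply, eq_comm]

end GeneratorMatrix

end DoublyCyclicCode

theorem theorem3p3 {F : Type*} [Field F] [Finite F] (n : ℕ) [NeZero n]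
    (hchar : ¬ ringChar F ∣ n)
    (σ : CyclicAlgebra F n ≃ₐ[F] CyclicAlgebra F n)
    (S : Finset (CyclicAlgebra F n)) (hS : S.Nonempty)
    (hSE : (S : Set (CyclicAlgebra F n)) ⊆ primitiveIdempotents F n)
    (b m : ℕ)
    (hdisj : ∀ j, 1 ≤ j → j ≤ b →
      Disjoint (S : Set (CyclicAlgebra F n)) ((σ ^ j) '' (S : Set (CyclicAlgebra F n))))
    (hm : 1 ≤ m) (hmb : m ≤ b)
    (c : CyclicAlgebra F n) (hc : c = ∑ ε ∈ S, ε)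
    (k : ℕ) (hk : k = blockDim c) :
    -- (a)
    (genPoly σ c m = PiretAlgebra.ι σ c * ∑ ν ∈ Finset.range (m + 1), PiretAlgebra.z σ ^ ν ∧
      genPoly σ c m = PiretAlgebra.ι σ c * ((List.range' 1 m).map fun ν =>
        1 + PiretAlgebra.z σ * PiretAlgebra.ι σ ((σ ^ ν) c)).prod) ∧
    -- (b)
    (genPoly σ c m * genUnit σ c m = PiretAlgebra.ι σ c ∧
      IsUnit (genUnit σ c m) ∧
      genUnit σ c m =
        1 - PiretAlgebra.z σ * PiretAlgebra.ι σ (∑ ν ∈ Finset.Icc 1 m, (σ ^ ν) c)) ∧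
    -- (c)
    ((im (genMatrix σ c m) : Set (Fin n → Polynomial F)) =
        v σ '' (Ideal.span {genPoly σ c m} : Ideal (PiretAlgebra σ)) ∧
      IsSigmaCyclic σ (im (genMatrix σ c m)) ∧
      Module.finrank (Polynomial F) (im (genMatrix σ c m)) = k) ∧
    -- (d)
    ((∃ D : Submodule (Polynomial F) (Fin n → Polynomial F), IsCompl (im (genMatrix σ c m)) D) ∧
      RightInvertible (genMatrix σ c m)) ∧
    -- (e)
    IsMinimal (genMatrix σ c m) ∧
    -- (f)
    (IsConvolutionalCode (im (genMatrix σ c m)) k (k * m) ∧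
      IsMemory (im (genMatrix σ c m)) m ∧
      ∀ ν : Multiset (WithBot ℕ), IsForneyIndices (im (genMatrix σ c m)) ν ↔
        ν = Multiset.replicate k (m : WithBot ℕ)) := by
  have hmin : ∀ ε ∈ S, IsMinimalIdempotent ε := fun ε hε =>
    isMinimalIdempotent_of_mem hchar (hSE hε)
  have hidem : c * c = c := by rw [hc, sum_mul_sum_eq_self hmin]
  have hc0 : c ≠ 0 := by
    rw [hc]
    exact sum_ne_zero hS hmin fun ε hε => ne_zero_of_mem_primitiveIdempotents (hSE hε)
  have horth : ∀ j, 1 ≤ j → j ≤ b → c * (σ ^ j) c = 0 := fun j h1 hj => by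
    rw [hc]
    exact sum_mul_map_sum_eq_zero hmin
      (σ ^ j : CyclicAlgebra F n ≃ₐ[F] CyclicAlgebra F n).toRingEquiv
      (hdisj j h1 hj)
  have hgu := genPoly_mul_genUnit hidem horth (hm.trans hmb) hmb
  have hinv := rightInvertible_genMatrix σ m hgu
  have hdeg := natDegree_genMatrix_le σ c m
  have hlead : LinearIndependent F ((genMatrix σ c m).map fun q => q.coeff m).row := by
    rw [genMatrix_map_coeff]
    exact linearIndependent_coeffMatrix σ c m
  subst hk
  exact ⟨⟨genPoly_eq_coe_mul σ c m, genPoly_eq_prod hidem horth hmb⟩,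
    ⟨hgu, isUnit_genUnit horth (hm.trans hmb), genUnit_eq horth hmb⟩,
    ⟨im_genMatrix_eq σ m hidem, isSigmaCyclic_im_genMatrix σ m hidem, hinv.finrank_im⟩,
    ⟨hinv.exists_isCompl, hinv⟩,
    isMinimal_of_leading hinv hdeg hlead,
    ⟨_, hinv, rfl, overallConstraintLength_eq hdeg hlead⟩,
    isMemory_im (blockDim_pos hc0) hinv hdeg hlead,
    isForneyIndices_iff hinv hdeg hlead⟩
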